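/- Let $\mathfrak A$ be a countably infinite alphabet and let $\mathfrak A^*$ be the free monoid over it. For words $\mathbf u,\mathbf v\in\mathfrak A^*$ write $\mathbf u\,\gamma\,\mathbf v$ if $\mathbf u$ and $\mathbf v$ are related by the congruence generated by the relations $x=x^2$ ($x\in\mathfrak A$) and the same letters occur at least twice in $\mathbf u$ as in $\mathbf v$; this is a congruence on $\mathfrak A^*$. For a set $\mathtt W\subseteq\mathfrak A^*/\gamma$ let $M_\gamma(\mathtt W)$ be the Rees quotient of $\mathfrak A^*/\gamma$ over the ideal of all elements that are not factors of elements of $\mathtt W$ (where $\mathtt v$ is a factor of $\mathtt u$ if $\mathtt u=\mathtt p\mathtt v\mathtt s$ for some $\mathtt p,\mathtt s$), and let $\mathbb M_\gamma(\mathtt W)$ be the variety of monoids generated by $M_\gamma(\mathtt W)$. For a letter $x$ write $\mathtt x=\{x\}$ and $\mathtt x^+=\{x^2,x^3,\dots\}$ for the $\gamma$-classes of $x$ and $x^2$. Consider the semigroups with zero $$E=\langle e,c\mid e^2=e,\ c^2=ec=0,\ ce=c\rangle,\qquad B_0=\langle e,f,c\mid e^2=e,\ f^2=f,\ ef=fe=0,\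 ec=cf=c\rangle,$$ $$A_0=\langle e,f\mid e^2=e,\ f^2=f,\ ef=0\rangle,$$ and let $\mathbb E$, $\mathbb B_0$, $\mathbb A_0$ be the varieties of monoids generated by the monoids $E^1$, $B_0^1$, $A_0^1$ obtained by adjoining an identity element. Let $\overline{\mathbb V}$ denote the dual of a variety $\mathbb V$, that is, the class of all monoids anti-isomorphic to members of $\mathbb V$, and let $\vee$ be the join of varieties. Let $a,b,t\in\mathfrak A$ with $a\neq b$ and $a\neq t$. Then: (i) $\mathbb E=\mathbb M_\gamma(\{\mathtt{t}\mathtt{a}^+\})$; (ii) $\overline{\mathbb E}=\mathbb M_\gamma(\{\mathtt{a}^+\mathtt{t}\})$; (iii) $\mathbb E\vee\overline{\mathbb E}=\mathbb B_0=\mathbb M_\gamma(\{\mathtt{t}\mathtt{a}^+,\ \mathtt{a}^+\mathtt{t}\})=\mathbb M_\gamma(\{\mathtt{a}^+\mathtt{t}\mathtt{a}^+\})$; (iv) $\mathbb A_0=\mathbb M_\gamma(\{\mathtt{a}^+\mathtt{b}^+\})$. -/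

import Mathlib

namespace ReesVar

/-! ### Varieties of monoids -/

/-- A variety of monoids: a class of monoids closed under homomorphic images, submonoids (up to
isomorphism) and arbitrary direct products. -/
structure IsVariety (V : Set MonCat.{0}) : Prop where
  image : ∀ (M N : MonCat.{0}) (f : M →* N), M ∈ V → Function.Surjective f → N ∈ V
  sub : ∀ (M N : MonCat.{0}) (f : M →* N), N ∈ V → Function.Injective f → M ∈ V
  prod : ∀ (ι : Type) (M : ι → MonCat.{0}), (∀ i, M i ∈ V) → MonCat.of (∀ i, M i) ∈ V

/-- The smallest variety containing a class of monoids. -/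
def varClass (K : Set MonCat.{0}) : Set MonCat.{0} := ⋂₀ {V | IsVariety V ∧ K ⊆ V}

/-- The variety generated by a monoid `M`. -/
def varGen (M : Type) [Monoid M] : Set MonCat.{0} := varClass {MonCat.of M}

/-- The join of two varieties: the smallest variety containing both. -/
def join (V W : Set MonCat.{0}) : Set MonCat.{0} := varClass (V ∪ W)

/-- The dual of a variety: all monoids anti-isomorphic to one of its members. -/
def dual (V : Set MonCat.{0}) : Set MonCat.{0} := {N | ∃ M ∈ V, Nonempty (N ≃* (M)ᵐᵒᵖ)}

/-! ### Semigroups given by a presentation with zero -/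

/-- The free semigroup with zero on `X`. -/
abbrev ZWord (X : Type) : Type := WithZero (FreeSemigroup X)

/-- A generator as an element of the free semigroup with zero. -/
def gen {X : Type} (x : X) : ZWord X := ((FreeSemigroup.of x : FreeSemigroup X) : ZWord X)

/-- The semigroup with zero generated by `X` subject to the relations `r`. -/
abbrev Presented {X : Type} (r : ZWord X → ZWord X → Prop) : Type := (conGen r).Quotient

/-- Generators of `E`. -/
inductive EGen : Type
  | e | c

/-- Relations of `E`: `e² = e`, `c² = ec = 0`, `ce = c`. -/
inductive ERel : ZWord EGen → ZWord EGen → Prop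
  | ee : ERel (gen .e * gen .e) (gen .e)
  | cc : ERel (gen .c * gen .c) 0
  | ec : ERel (gen .e * gen .c) 0
  | ce : ERel (gen .c * gen .e) (gen .c)

/-- The monoid `E¹`: the semigroup `E` with an identity element adjoined. -/
abbrev E1 : Type := WithOne (Presented ERel)

/-- Generators of `B₀`. -/
inductive BGen : Type
  | e | f | c

/-- Relations of `B₀`: `e² = e`, `f² = f`, `ef = fe = 0`, `ec = cf = c`. -/
inductive BRel : ZWord BGen → ZWord BGen → Prop
  | ee : BRel (gen .e * gen .e) (gen .e)
  | ff : BRel (gen .f * gen .f) (gen .f)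
  | ef : BRel (gen .e * gen .f) 0
  | fe : BRel (gen .f * gen .e) 0
  | ec : BRel (gen .e * gen .c) (gen .c)
  | cf : BRel (gen .c * gen .f) (gen .c)

/-- The monoid `B₀¹`: the semigroup `B₀` with an identity element adjoined. -/
abbrev B01 : Type := WithOne (Presented BRel)

/-- Generators of `A₀`. -/
inductive AGen : Type
  | e | f

/-- Relations of `A₀`: `e² = e`, `f² = f`, `ef = 0`. -/
inductive ARel : ZWord AGen → ZWord AGen → Prop
  | ee : ARel (gen .e * gen .e) (gen .e)
  | ff : ARel (gen .f * gen .f) (gen .f)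
  | ef : ARel (gen .e * gen .f) 0

/-- The monoid `A₀¹`: the semigroup `A₀` with an identity element adjoined. -/
abbrev A01 : Type := WithOne (Presented ARel)

/-! ### The monoids `M_τ(W)` -/

/-- The Rees congruence of a two-sided ideal: `I` is collapsed to one element. -/
def reesCon {S : Type} [Monoid S] (I : Set S)
    (hI : ∀ s ∈ I, ∀ x : S, x * s ∈ I ∧ s * x ∈ I) : Con S where
  r u v := u = v ∨ (u ∈ I ∧ v ∈ I)
  iseqv :=
    { refl := fun _ => Or.inl rfl
      symm := by
        rintro u v (h | ⟨h1, h2⟩)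
        · exact Or.inl h.symm
        · exact Or.inr ⟨h2, h1⟩
      trans := by
        rintro u v w (rfl | ⟨h1, h2⟩) (rfl | ⟨h3, h4⟩)
        · exact Or.inl rfl
        · exact Or.inr ⟨h3, h4⟩
        · exact Or.inr ⟨h1, h2⟩
        · exact Or.inr ⟨h1, h4⟩ }
  mul' := by
    rintro u v w x (rfl | ⟨h1, h2⟩) (rfl | ⟨h3, h4⟩)
    · exact Or.inl rfl
    · exact Or.inr ⟨(hI _ h3 _).1, (hI _ h4 _).1⟩
    · exact Or.inr ⟨(hI _ h1 _).2, (hI _ h2 _).2⟩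
    · exact Or.inr ⟨(hI _ h1 _).2, (hI _ h2 _).2⟩

/-- `v ≤ u` if and only if `u = p v s` for some `p`, `s`. -/
def FactorOf {S : Type} [Monoid S] (v u : S) : Prop := ∃ p s : S, u = p * v * s

/-- The closure of a set of elements under taking factors. -/
def factorClosure {S : Type} [Monoid S] (W : Set S) : Set S := {v | ∃ u ∈ W, FactorOf v u}

theorem compl_factorClosure_ideal {S : Type} [Monoid S] (W : Set S) :
    ∀ s ∈ (factorClosure W)ᶜ, ∀ x : S,
      x * s ∈ (factorClosure W)ᶜ ∧ s * x ∈ (factorClosure W)ᶜ := by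
  intro s hs x
  constructor
  · rintro ⟨u, hu, p, q, h⟩
    exact hs ⟨u, hu, p * x, q, by rw [h]; simp only [mul_assoc]⟩
  · rintro ⟨u, hu, p, q, h⟩
    exact hs ⟨u, hu, p, x * q, by rw [h]; simp only [mul_assoc]⟩

/-- `M_τ(W)`: the Rees quotient of `𝔄*/τ` over the ideal of all `τ`-words that are not factors of
`τ`-words from `W`. -/
abbrev MM {α : Type} (τ : Con (FreeMonoid α)) (W : Set τ.Quotient) : Type :=
  (reesCon (factorClosure W)ᶜ (compl_factorClosure_ideal W)).Quotient

/-! ### The congruence `γ` -/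

/-- The congruence on the free monoid induced by the relations `a = a²` for all letters `a`. -/
def tau1 (α : Type) : Con (FreeMonoid α) :=
  conGen fun u v => ∃ a : α, u = FreeMonoid.of a ∧ v = FreeMonoid.of a * FreeMonoid.of a

/-- The set of letters of a word. -/
def con {α : Type} (u : FreeMonoid α) : Set α := {x | x ∈ u.toList}

open Classical in
/-- The set of letters that occur at least twice in a word. -/
def mult {α : Type} (u : FreeMonoid α) : Set α := {x | 2 ≤ u.toList.count x}

theorem con_eq_of_tau1 {α : Type} {u v : FreeMonoid α} (h : tau1 α u v) : con u = con v := by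
  induction h with
  | of u v h => obtain ⟨a, rfl, rfl⟩ := h; ext x; simp [con]
  | refl u => rfl
  | symm _ ih => exact ih.symm
  | trans _ _ ih1 ih2 => exact ih1.trans ih2
  | mul _ _ ih1 ih2 =>
    ext x
    have h1 := Set.ext_iff.1 ih1 x
    have h2 := Set.ext_iff.1 ih2 x
    simp only [con, Set.mem_ofPred_eq, FreeMonoid.toList_mul, List.mem_append] at *
    rw [h1, h2]

theorem mem_mult_mul {α : Type} (u v : FreeMonoid α) (x : α) :
    x ∈ mult (u * v) ↔ x ∈ mult u ∨ x ∈ mult v ∨ (x ∈ con u ∧ x ∈ con v) := by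
  classical
  simp only [mult, con, Set.mem_ofPred_eq, FreeMonoid.toList_mul, List.count_append,
    ← List.count_pos_iff]
  omega

/-- The congruence `γ`: `u γ v` if and only if `u τ₁ v` and `u`, `v` have the same multiple
letters. -/
def gamma (α : Type) : Con (FreeMonoid α) where
  r u v := tau1 α u v ∧ mult u = mult v
  iseqv :=
    { refl := fun u => ⟨(tau1 α).refl u, rfl⟩
      symm := fun h => ⟨(tau1 α).symm h.1, h.2.symm⟩
      trans := fun h k => ⟨(tau1 α).trans h.1 k.1, h.2.trans k.2⟩ }
  mul' := by
    intro u v w x h k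
    refine ⟨(tau1 α).mul h.1 k.1, ?_⟩
    ext y
    rw [mem_mult_mul, mem_mult_mul, h.2, k.2, con_eq_of_tau1 h.1, con_eq_of_tau1 k.1]

/-- The `γ`-word `{a}`. -/
def letter {α : Type} (a : α) : (gamma α).Quotient := ((FreeMonoid.of a : FreeMonoid α))

/-- The `γ`-word `a⁺ = {a², a³, …}`, given as the `γ`-class of `a²`. -/
def plus {α : Type} (a : α) : (gamma α).Quotient :=
  ((FreeMonoid.of a * FreeMonoid.of a : FreeMonoid α))

/-- The variety generated by `M_γ(W)`. -/
def varM {α : Type} (W : Set (gamma α).Quotient) : Set MonCat.{0} := varGen (MM (gamma α) W)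

end ReesVar

namespace ReesVar

/-! ### Varieties -/

/-! Each equality of varieties splits into two memberships between explicit generators, after
`presentedEquiv` has turned the presented monoids into finite tables.

Upper bounds are Birkhoff's argument (`MM_mem_varGen`): the Rees quotient lies in the variety of `N`
if every identity u = v of `N` with u a factor of W forces u γ v. Identities of E¹ preserve the
content, the set of multiple letters and, for a letter y occurring at most once, the letters before
y; those of the dual preserve the letters after y; those of A₀¹ preserve the order relation for all
pairs of distinct letters. For the factors at hand these data determine the γ-class: a two-letter
word with no y before x is a block of x followed by a block of y modulo x = x², and a word with a
single y is that y with an optional block of x on either side.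

Lower bounds: E¹, its dual and A₀¹ embed into the Rees quotients through explicit words
(`mem_varM_of_words`), while B₀¹ is a quotient of a submonoid of E¹ times its dual
(`IsVariety.BC_mem`). Since E¹ and its dual embed into B₀¹, the join is the variety of B₀¹. -/

theorem isVariety_varClass (K : Set MonCat.{0}) : IsVariety (varClass K) where
  image M N f hM hf := fun V hV => hV.1.image M N f (hM V hV) hf
  sub M N f hN hf := fun V hV => hV.1.sub M N f (hN V hV) hf
  prod ι M h := fun V hV => hV.1.prod ι M fun i => h i V hV

theorem subset_varClass (K : Set MonCat.{0}) : K ⊆ varClass K := fun _ hM _ hV => hV.2 hM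

theorem varClass_subset {K V : Set MonCat.{0}} (hV : IsVariety V) (h : K ⊆ V) :
    varClass K ⊆ V := fun _ hM => hM V ⟨hV, h⟩

theorem isVariety_varGen (M : Type) [Monoid M] : IsVariety (varGen M) := isVariety_varClass _

theorem self_mem_varGen (M : Type) [Monoid M] : MonCat.of M ∈ varGen M :=
  subset_varClass _ rfl

theorem varGen_subset {M : Type} [Monoid M] {V : Set MonCat.{0}} (hV : IsVariety V)
    (h : MonCat.of M ∈ V) : varGen M ⊆ V :=
  varClass_subset hV (by rintro _ rfl; exact h)

theorem varGen_eq {M N : Type} [Monoid M] [Monoid N] (h : MonCat.of M ∈ varGen N)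
    (k : MonCat.of N ∈ varGen M) : varGen M = varGen N :=
  (varGen_subset (isVariety_varGen N) h).antisymm (varGen_subset (isVariety_varGen M) k)

theorem IsVariety.image_of {V : Set MonCat.{0}} (hV : IsVariety V) {M N : Type} [Monoid M]
    [Monoid N] (h : MonCat.of M ∈ V) (f : M →* N) (hf : Function.Surjective f) :
    MonCat.of N ∈ V := hV.image (MonCat.of M) (MonCat.of N) f h hf

theorem IsVariety.sub_of {V : Set MonCat.{0}} (hV : IsVariety V) {M N : Type} [Monoid M]
    [Monoid N] (h : MonCat.of N ∈ V) (f : M →* N) (hf : Function.Injective f) :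
    MonCat.of M ∈ V := hV.sub (MonCat.of M) (MonCat.of N) f h hf

theorem varGen_congr {M N : Type} [Monoid M] [Monoid N] (f : M ≃* N) : varGen M = varGen N :=
  varGen_eq ((isVariety_varGen N).sub_of (self_mem_varGen N) f.toMonoidHom f.injective)
    ((isVariety_varGen M).sub_of (self_mem_varGen M) f.symm.toMonoidHom f.symm.injective)

/-- A monoid lies in a variety as soon as some monoid mapping onto it has enough homomorphisms
into members of the variety. -/
theorem IsVariety.mem_of_separating {V : Set MonCat.{0}} (hV : IsVariety V) {F N : Type}
    [Monoid F] [Monoid N] (p : F →* N) (hp : Function.Surjective p) {ι : Type}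
    (M : ι → MonCat.{0}) (hM : ∀ i, M i ∈ V) (f : ∀ i, F →* M i)
    (h : ∀ u v, (∀ i, f i u = f i v) → p u = p v) : MonCat.of N ∈ V := by
  let Φ : F →* ∀ i, M i := MonoidHom.pi f
  -- The quotient of `F` by the common kernel embeds into the product and maps onto `N`.
  have hK : MonCat.of (Con.ker Φ).Quotient ∈ V :=
    hV.sub_of (hV.prod ι M hM) (Con.kerLift Φ) (Con.kerLift_injective Φ)
  have hle : Con.ker Φ ≤ Con.ker p := fun u v huv => h u v fun i => congrFun huv i
  exact hV.image_of hK (Con.lift (Con.ker Φ) p hle) (Con.lift_surjective_of_surjective hle hp)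

/-- Closure under isomorphism removes the existential, so closure properties of the dual can be
checked on opposites. -/
theorem IsVariety.mem_dual {V : Set MonCat.{0}} (hV : IsVariety V) (N : MonCat.{0}) :
    N ∈ dual V ↔ MonCat.of Nᵐᵒᵖ ∈ V := by
  constructor
  · rintro ⟨M, hM, ⟨f⟩⟩
    exact hV.image_of (M := M) hM ((MulEquiv.opOp M).trans (MulEquiv.op f.symm)).toMonoidHom
      (MulEquiv.surjective _)
  · intro h
    exact ⟨_, h, ⟨MulEquiv.opOp N⟩⟩

theorem IsVariety.dual {V : Set MonCat.{0}} (hV : IsVariety V) : IsVariety (dual V) where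
  image M N f hM hf := by
    rw [hV.mem_dual] at *
    exact hV.image_of hM (MonoidHom.op f) fun x =>
      (hf x.unop).elim fun y hy => ⟨MulOpposite.op y, congrArg MulOpposite.op hy⟩
  sub M N f hM hf := by
    rw [hV.mem_dual] at *
    exact hV.sub_of hM (MonoidHom.op f) fun x y h =>
      MulOpposite.unop_injective (hf (congrArg MulOpposite.unop h))
  prod ι M h := by
    rw [hV.mem_dual]
    refine hV.sub_of (hV.prod ι (fun i => MonCat.of (M i)ᵐᵒᵖ) fun i => (hV.mem_dual _).1 (h i))
      (M := (∀ i, M i)ᵐᵒᵖ)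
      { toFun := fun x i => MulOpposite.op (x.unop i)
        map_one' := rfl
        map_mul' := fun _ _ => rfl } ?_
    intro x y h
    exact MulOpposite.unop_injective
      (funext fun i => MulOpposite.op_injective (congrFun h i))

/-- The dual of a variety is a variety, so both inclusions follow from minimality and the
isomorphism of `M` with its double opposite. -/
theorem dual_varGen (M : Type) [Monoid M] : dual (varGen M) = varGen Mᵐᵒᵖ := by
  have hM := isVariety_varGen M
  have hO := isVariety_varGen Mᵐᵒᵖ
  apply Set.Subset.antisymm
  · intro N hN
    have h : varGen M ⊆ dual (varGen Mᵐᵒᵖ) :=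
      varGen_subset hO.dual ((hO.mem_dual _).2 (self_mem_varGen _))
    have := (hO.mem_dual _).1 (h ((hM.mem_dual N).1 hN))
    exact hO.image_of this (MulEquiv.opOp N).symm.toMonoidHom (MulEquiv.surjective _)
  · refine varGen_subset hM.dual ((hM.mem_dual _).2 ?_)
    exact hM.image_of (self_mem_varGen M) (MulEquiv.opOp M).toMonoidHom (MulEquiv.surjective _)

/-! ### Normal forms of presented semigroups -/

section Presented

variable {X : Type} {r : ZWord X → ZWord X → Prop} {N : Type} [MonoidWithZero N]

/-- Evaluation of words with zero. -/
def zeval (g : X → N) : ZWord X → N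
  | none => 0
  | some w => FreeSemigroup.lift g w

theorem zeval_mul (g : X → N) (u v : ZWord X) : zeval g (u * v) = zeval g u * zeval g v := by
  rcases u with _ | u
  · exact (zero_mul _).symm
  rcases v with _ | v
  · exact (mul_zero _).symm
  · exact map_mul (FreeSemigroup.lift g) u v

@[simp] theorem zeval_gen (g : X → N) (x : X) : zeval g (gen x) = g x :=
  FreeSemigroup.lift_of g x

@[simp] theorem zeval_zero (g : X → N) : zeval g 0 = 0 := rfl

theorem zeval_congr (g : X → N) (hr : ∀ u v, r u v → zeval g u = zeval g v) {u v : ZWord X}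
    (h : conGen r u v) : zeval g u = zeval g v := by
  induction h with
  | of u v h => exact hr u v h
  | refl u => rfl
  | symm _ ih => exact ih.symm
  | trans _ _ ih1 ih2 => exact ih1.trans ih2
  | mul _ _ ih1 ih2 => rw [zeval_mul, zeval_mul, ih1, ih2]

/-- The homomorphism from a presented semigroup with identity adjoined that is given by the images
of the generators. -/
def presentedLift (g : X → N) (hr : ∀ u v, r u v → zeval g u = zeval g v) :
    WithOne (Presented r) →* N :=
  WithOne.lift
    { toFun := fun q => Con.liftOn q (zeval g) fun _ _ h => zeval_congr g hr h
      map_mul' := fun p q => Con.induction_on₂ p q fun u v => zeval_mul g u v }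

/-- The image of a word with zero in the presented semigroup with identity adjoined. -/
def pmk (r : ZWord X → ZWord X → Prop) (u : ZWord X) : WithOne (Presented r) :=
  (((u : ZWord X) : Presented r) : WithOne (Presented r))

theorem pmk_mul (u v : ZWord X) : pmk r u * pmk r v = pmk r (u * v) := rfl

theorem pmk_eq {u v : ZWord X} (h : r u v) : pmk r u = pmk r v :=
  congrArg (fun q : Presented r => (q : WithOne (Presented r)))
    (Quotient.sound (ConGen.Rel.of u v h))

@[simp] theorem pmk_mul_zero (u : ZWord X) : pmk r u * pmk r 0 = pmk r 0 := by
  rw [pmk_mul, mul_zero]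

@[simp] theorem pmk_zero_mul (u : ZWord X) : pmk r 0 * pmk r u = pmk r 0 := by
  rw [pmk_mul, zero_mul]

/-- A presented semigroup with identity adjoined is isomorphic to a monoid with zero `N` in which
the relations hold, once every element of `N` has a normal form and these are closed under
multiplication by generators. -/
noncomputable def presentedEquiv (g : X → N) (hr : ∀ u v, r u v → zeval g u = zeval g v)
    (s : N → WithOne (Presented r)) (h1 : s 1 = 1) (h0 : s 0 = pmk r 0)
    (hs : ∀ x n, s (g x * n) = pmk r (gen x) * s n)
    (hsurj : ∀ n, presentedLift g hr (s n) = n) : WithOne (Presented r) ≃* N :=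
  { presentedLift g hr with
    invFun := s
    right_inv := hsurj
    left_inv := by
      intro x
      change s (presentedLift g hr x) = x
      refine WithOne.cases_on x (by rw [map_one, h1]) fun q => ?_
      induction q using Con.induction_on with
      | _ u =>
      rcases u with _ | w
      · exact h0
      · change s (FreeSemigroup.lift g w) = pmk r (w : ZWord X)
        -- Words grow by generators on the left, so left multiplication by generators is all that
        -- `hs` must control.
        refine FreeSemigroup.recOnMul w (fun x => ?_) fun x w _ ih => ?_
        · have := hs x 1
          rwa [mul_one, h1, mul_one] at this
        · rw [map_mul, FreeSemigroup.lift_of, hs, ih]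
          rfl }

end Presented

end ReesVar

namespace ReesVar

/-! ### Concrete multiplication tables -/

/-- The elements of `E¹`. -/
inductive EC : Type
  | one | e | c | z

/-- The elements of `B₀¹`. -/
inductive BC : Type
  | one | e | f | c | z

/-- The elements of `A₀¹`; here `g = fe`. -/
inductive AC : Type
  | one | e | f | g | z

namespace EC

/-- Multiplication of `E¹`. -/
def mul : EC → EC → EC
  | one, x => x
  | x, one => x
  | e, e => e
  | c, e => c
  | _, _ => z

instance : MonoidWithZero EC where
  mul := mul
  one := one
  zero := z
  mul_assoc := by rintro ⟨⟩ ⟨⟩ ⟨⟩ <;> rfl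
  one_mul := by rintro ⟨⟩ <;> rfl
  mul_one := by rintro ⟨⟩ <;> rfl
  zero_mul := by rintro ⟨⟩ <;> rfl
  mul_zero := by rintro ⟨⟩ <;> rfl

end EC

namespace BC

/-- Multiplication of `B₀¹`. -/
def mul : BC → BC → BC
  | one, x => x
  | x, one => x
  | e, e => e
  | f, f => f
  | e, c => c
  | c, f => c
  | _, _ => z

instance : MonoidWithZero BC where
  mul := mul
  one := one
  zero := z
  mul_assoc := by rintro ⟨⟩ ⟨⟩ ⟨⟩ <;> rfl
  one_mul := by rintro ⟨⟩ <;> rfl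
  mul_one := by rintro ⟨⟩ <;> rfl
  zero_mul := by rintro ⟨⟩ <;> rfl
  mul_zero := by rintro ⟨⟩ <;> rfl

end BC

namespace AC

/-- Multiplication of `A₀¹`. -/
def mul : AC → AC → AC
  | one, x => x
  | x, one => x
  | e, e => e
  | f, f => f
  | f, e => g
  | f, g => g
  | g, e => g
  | _, _ => z

instance : MonoidWithZero AC where
  mul := mul
  one := one
  zero := z
  mul_assoc := by rintro ⟨⟩ ⟨⟩ ⟨⟩ <;> rfl
  one_mul := by rintro ⟨⟩ <;> rfl
  mul_one := by rintro ⟨⟩ <;> rfl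
  zero_mul := by rintro ⟨⟩ <;> rfl
  mul_zero := by rintro ⟨⟩ <;> rfl

end AC

/-- Normal forms in `E¹`. -/
def EC.nf : EC → E1
  | one => 1
  | e => pmk ERel (gen .e)
  | c => pmk ERel (gen .c)
  | z => pmk ERel 0

/-- The generators of `E` in the multiplication table. -/
def EC.ofGen : EGen → EC
  | .e => e
  | .c => c

/-- `E¹` has the expected multiplication table. -/
noncomputable def E1Equiv : E1 ≃* EC :=
  presentedEquiv EC.ofGen
    (by rintro _ _ (_ | _ | _ | _) <;> simp only [zeval_mul, zeval_gen, zeval_zero] <;> rfl)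
    EC.nf rfl rfl
    (by
      have ee := pmk_eq ERel.ee
      have cc := pmk_eq ERel.cc
      have ec := pmk_eq ERel.ec
      have ce := pmk_eq ERel.ce
      simp only [← pmk_mul] at ee cc ec ce
      rintro (_ | _) (_ | _ | _ | _)
      · exact (mul_one _).symm
      · exact ee.symm
      · exact ec.symm
      · exact (pmk_mul_zero _).symm
      · exact (mul_one _).symm
      · exact ce.symm
      · exact cc.symm
      · exact (pmk_mul_zero _).symm)
    (by rintro ⟨⟩ <;> rfl)

/-- Normal forms in `B₀¹`. -/
def BC.nf : BC → B01
  | one => 1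
  | e => pmk BRel (gen .e)
  | f => pmk BRel (gen .f)
  | c => pmk BRel (gen .c)
  | z => pmk BRel 0

/-- The generators of `B₀` in the multiplication table. -/
def BC.ofGen : BGen → BC
  | .e => e
  | .f => f
  | .c => c

/-- `B₀¹` has the expected multiplication table. -/
noncomputable def B01Equiv : B01 ≃* BC :=
  presentedEquiv BC.ofGen
    (by rintro _ _ (_ | _ | _ | _ | _ | _) <;>
          simp only [zeval_mul, zeval_gen, zeval_zero] <;> rfl)
    BC.nf rfl rfl
    (by
      have ee := pmk_eq BRel.ee
      have ff := pmk_eq BRel.ff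
      have ef := pmk_eq BRel.ef
      have fe := pmk_eq BRel.fe
      have ec := pmk_eq BRel.ec
      have cf := pmk_eq BRel.cf
      simp only [← pmk_mul] at ee ff ef fe ec cf
      -- Three products are not among the relations; expanding c as ec or cf produces the factor fe
      -- = 0 or, for cc, fc = 0.
      have fc : pmk BRel (gen .f) * pmk BRel (gen .c) = pmk BRel 0 := by
        rw [← ec, ← mul_assoc, fe, pmk_zero_mul]
      have ce : pmk BRel (gen .c) * pmk BRel (gen .e) = pmk BRel 0 := by
        rw [← cf, mul_assoc, fe, pmk_mul_zero]
      have cc : pmk BRel (gen .c) * pmk BRel (gen .c) = pmk BRel 0 := by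
        nth_rw 1 [← cf]
        rw [mul_assoc, fc, pmk_mul_zero]
      rintro (_ | _ | _) (_ | _ | _ | _ | _)
      · exact (mul_one _).symm
      · exact ee.symm
      · exact ef.symm
      · exact ec.symm
      · exact (pmk_mul_zero _).symm
      · exact (mul_one _).symm
      · exact fe.symm
      · exact ff.symm
      · exact fc.symm
      · exact (pmk_mul_zero _).symm
      · exact (mul_one _).symm
      · exact ce.symm
      · exact cf.symm
      · exact cc.symm
      · exact (pmk_mul_zero _).symm)
    (by rintro ⟨⟩ <;> rfl)

/-- Normal forms in `A₀¹`. -/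
def AC.nf : AC → A01
  | one => 1
  | e => pmk ARel (gen .e)
  | f => pmk ARel (gen .f)
  | g => pmk ARel (gen .f) * pmk ARel (gen .e)
  | z => pmk ARel 0

/-- The generators of `A₀` in the multiplication table. -/
def AC.ofGen : AGen → AC
  | .e => e
  | .f => f

/-- `A₀¹` has the expected multiplication table. -/
noncomputable def A01Equiv : A01 ≃* AC :=
  presentedEquiv AC.ofGen
    (by rintro _ _ (_ | _ | _) <;> simp only [zeval_mul, zeval_gen, zeval_zero] <;> rfl)
    AC.nf rfl rfl
    (by
      have ee := pmk_eq ARel.ee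
      have ff := pmk_eq ARel.ff
      have ef := pmk_eq ARel.ef
      simp only [← pmk_mul] at ee ff ef
      have eg : pmk ARel (gen .e) * (pmk ARel (gen .f) * pmk ARel (gen .e)) = pmk ARel 0 := by
        rw [← mul_assoc, ef, pmk_zero_mul]
      have fg : pmk ARel (gen .f) * (pmk ARel (gen .f) * pmk ARel (gen .e)) =
          pmk ARel (gen .f) * pmk ARel (gen .e) := by
        rw [← mul_assoc, ff]
      rintro (_ | _) (_ | _ | _ | _ | _)
      · exact (mul_one _).symm
      · exact ee.symm
      · exact ef.symm
      · exact eg.symm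
      · exact (pmk_mul_zero _).symm
      · exact (mul_one _).symm
      · rfl
      · exact ff.symm
      · exact fg.symm
      · exact (pmk_mul_zero _).symm)
    (by rintro ⟨⟩ <;> rfl)

/-! ### Embeddings between the concrete monoids -/

/-- The embedding of `E¹` into `B₀¹`. -/
def EC.toBC : EC →* BC where
  toFun | one => .one | e => .f | c => .c | z => .z
  map_one' := rfl
  map_mul' := by rintro ⟨⟩ ⟨⟩ <;> rfl

theorem EC.toBC_injective : Function.Injective EC.toBC := by
  rintro ⟨⟩ ⟨⟩ h <;> first | rfl | exact BC.noConfusion h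

/-- The embedding of the dual of `E¹` into `B₀¹`. -/
def EC.opToBC : ECᵐᵒᵖ →* BC where
  toFun x := match x.unop with | one => .one | e => .e | c => .c | z => .z
  map_one' := rfl
  map_mul' := by rintro ⟨⟨⟩⟩ ⟨⟨⟩⟩ <;> rfl

theorem EC.opToBC_injective : Function.Injective EC.opToBC := by
  rintro ⟨⟨⟩⟩ ⟨⟨⟩⟩ h <;> first | rfl | exact BC.noConfusion h

/-- The embedding of `E¹` into `A₀¹`. -/
def EC.toAC : EC →* AC where
  -- The image g = fe of c works because ge = g while eg = gg = 0.
  toFun | one => .one | e => .e | c => .g | z => .z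
  map_one' := rfl
  map_mul' := by rintro ⟨⟩ ⟨⟩ <;> rfl

theorem EC.toAC_injective : Function.Injective EC.toAC := by
  rintro ⟨⟩ ⟨⟩ h <;> first | rfl | exact AC.noConfusion h

/-- The submonoid of `E¹` times its dual that is generated by `(1, e)`, `(e, 1)` and `(c, c)`. -/
def prodSub : Submonoid (EC × ECᵐᵒᵖ) where
  carrier := {p | match p.1, p.2.unop with
    | .one, .one | .one, .e | .e, .one | .e, .e | .c, .c | .z, .c | .c, .z | .z, .z => True
    | _, _ => False}
  one_mem' := trivial
  mul_mem' := by
    rintro ⟨⟨⟩, ⟨⟨⟩⟩⟩ ⟨⟨⟩, ⟨⟨⟩⟩⟩ h k <;> first | exact trivial | exact h.elim | exact k.elim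

/-- The homomorphism from `prodSub` onto `B₀¹`. -/
def prodSubToBC : prodSub →* BC where
  -- The remaining elements (e, e), (z, c), (c, z), (z, z) form an ideal, which is collapsed to
  -- zero.
  toFun p := match p.1.1, p.1.2.unop with
    | .one, .one => .one
    | .one, .e => .e
    | .e, .one => .f
    | .c, .c => .c
    | _, _ => .z
  map_one' := rfl
  map_mul' := by
    rintro ⟨⟨⟨⟩, ⟨⟨⟩⟩⟩, h⟩ ⟨⟨⟨⟩, ⟨⟨⟩⟩⟩, k⟩ <;> first | rfl | exact h.elim

theorem prodSubToBC_surjective : Function.Surjective prodSubToBC := by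
  rintro ⟨⟩
  · exact ⟨1, rfl⟩
  · exact ⟨⟨(.one, .op .e), trivial⟩, rfl⟩
  · exact ⟨⟨(.e, .op .one), trivial⟩, rfl⟩
  · exact ⟨⟨(.c, .op .c), trivial⟩, rfl⟩
  · exact ⟨⟨(.z, .op .z), trivial⟩, rfl⟩

theorem IsVariety.BC_mem {V : Set MonCat.{0}} (hV : IsVariety V) (h : MonCat.of EC ∈ V)
    (k : MonCat.of ECᵐᵒᵖ ∈ V) : MonCat.of BC ∈ V :=
  hV.mem_of_separating prodSubToBC prodSubToBC_surjective (ι := Bool)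
    (fun i => if i then MonCat.of EC else MonCat.of ECᵐᵒᵖ)
    (by rintro (_ | _) <;> assumption)
    (fun
      | true => (MonoidHom.fst EC ECᵐᵒᵖ).comp prodSub.subtype
      | false => (MonoidHom.snd EC ECᵐᵒᵖ).comp prodSub.subtype)
    fun _ _ huv => congrArg prodSubToBC (Subtype.ext (Prod.ext (huv true) (huv false)))

end ReesVar

namespace ReesVar

/-! ### Invariants of words -/

variable {α : Type}

/-- Some occurrence of `x` in `u` precedes some occurrence of `y`. -/
def before (x y : α) (u : FreeMonoid α) : Prop := [x, y].Sublist u.toList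

theorem mem_con_one (x : α) : x ∈ con (1 : FreeMonoid α) ↔ False := by simp [con]

theorem mem_con_of (x y : α) : x ∈ con (FreeMonoid.of y) ↔ x = y := by simp [con]

theorem mem_con_mul (x : α) (u v : FreeMonoid α) :
    x ∈ con (u * v) ↔ x ∈ con u ∨ x ∈ con v := by simp [con]

theorem mem_mult_one (x : α) : x ∈ mult (1 : FreeMonoid α) ↔ False := by simp [mult]

theorem mem_mult_of (x y : α) : x ∈ mult (FreeMonoid.of y) ↔ False := by
  classical
  simp only [mult, Set.mem_ofPred_eq, FreeMonoid.toList_of, iff_false, not_le]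
  exact (List.count_le_length (a := x) (l := [y])).trans_lt (by simp)

theorem mult_subset_con (u : FreeMonoid α) : mult u ⊆ con u := by
  classical
  intro x hx
  have : 0 < u.toList.count x := two_pos.trans_le hx
  exact List.count_pos_iff.1 this

theorem before_one (x y : α) : before x y 1 ↔ False := by simp [before]

theorem before_of (x y z : α) : before x y (FreeMonoid.of z) ↔ False := by
  simp only [before, FreeMonoid.toList_of, iff_false]
  intro h
  simpa using h.length_le

theorem before_mul (x y : α) (u v : FreeMonoid α) :
    before x y (u * v) ↔ before x y u ∨ before x y v ∨ (x ∈ con u ∧ y ∈ con v) := by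
  simp only [before, con, Set.mem_ofPred_eq, FreeMonoid.toList_mul]
  constructor
  · intro h
    obtain ⟨l₁, l₂, h, h₁, h₂⟩ := List.sublist_append_iff.1 h
    -- The left factor contributes none, one or both of the two letters.
    rcases l₁ with _ | ⟨p, _ | ⟨q, l₁⟩⟩
    · rw [List.nil_append] at h
      exact .inr (.inl (h ▸ h₂))
    · simp only [List.cons_append, List.nil_append, List.cons.injEq] at h
      obtain ⟨rfl, rfl⟩ := h
      exact .inr (.inr ⟨List.singleton_sublist.1 h₁, List.singleton_sublist.1 h₂⟩)
    · simp only [List.cons_append, List.cons.injEq, List.nil_eq, List.append_eq_nil_iff] at h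
      obtain ⟨rfl, rfl, rfl, rfl⟩ := h
      exact .inl h₁
  · rintro (h | h | ⟨h, k⟩)
    · exact h.trans (List.sublist_append_left _ _)
    · exact h.trans (List.sublist_append_right _ _)
    · exact (List.singleton_sublist.2 h).append (List.singleton_sublist.2 k)

theorem before.mem_con {x y : α} {u : FreeMonoid α} (h : before x y u) :
    x ∈ con u ∧ y ∈ con u :=
  ⟨h.subset (by simp), h.subset (by simp)⟩

/-- Doubling a letter creates no new ordered pair of distinct letters; for x = y this would fail. -/
theorem before_iff_of_tau1 {x y : α} (hxy : x ≠ y) {u v : FreeMonoid α} (h : tau1 α u v) :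
    before x y u ↔ before x y v := by
  induction h with
  | of u v h =>
    obtain ⟨a, rfl, rfl⟩ := h
    simp only [before_mul, before_of, mem_con_of, false_or, false_iff]
    rintro ⟨rfl, rfl⟩
    exact hxy rfl
  | refl u => rfl
  | symm _ ih => exact ih.symm
  | trans _ _ ih1 ih2 => exact ih1.trans ih2
  | mul h k ih1 ih2 => rw [before_mul, before_mul, ih1, ih2, con_eq_of_tau1 h, con_eq_of_tau1 k]

/-! ### Normal forms of two-letter words modulo `tau1` -/

open Classical in
/-- The letter `x` if `P` holds, and the empty word otherwise. -/
noncomputable def letterIf (x : α) (P : Prop) : FreeMonoid α := if P then FreeMonoid.of x else 1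

theorem letterIf_pos (x : α) {P : Prop} (h : P) : letterIf x P = FreeMonoid.of x := if_pos h

theorem letterIf_neg (x : α) {P : Prop} (h : ¬P) : letterIf x P = 1 := if_neg h

theorem tau1_sq (x : α) : tau1 α (FreeMonoid.of x * FreeMonoid.of x) (FreeMonoid.of x) :=
  (tau1 α).symm (ConGen.Rel.of _ _ ⟨x, rfl, rfl⟩)

theorem tau1_of_mul_letterIf (x : α) (P : Prop) :
    tau1 α (FreeMonoid.of x * letterIf x P) (FreeMonoid.of x) := by
  by_cases h : P
  · rw [letterIf_pos x h]
    exact tau1_sq x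
  · rw [letterIf_neg x h, mul_one]
    exact (tau1 α).refl _

/-- All x precede all y, so the word is two blocks, each collapsing to at most one letter. In the
induction a leading x is absorbed by the x-block, and a leading y excludes x from the rest. -/
theorem tau1_normalForm_of_not_before {x y : α} (hxy : x ≠ y) (u : FreeMonoid α)
    (hu : con u ⊆ {x, y}) (h : ¬before y x u) :
    tau1 α u (letterIf x (x ∈ con u) * letterIf y (y ∈ con u)) := by
  induction u using FreeMonoid.inductionOn' with
  | one =>
    simp only [mem_con_one, letterIf_neg _ not_false, mul_one]
    exact (tau1 α).refl _
  | of_mul z w ih =>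
    simp only [before_mul, before_of, mem_con_of, false_or, not_or, not_and] at h
    have hw := ih (fun p hp => hu ((mem_con_mul _ _ _).2 (.inr hp))) h.1
    have hz : z = x ∨ z = y := hu ((mem_con_mul _ _ _).2 (.inl ((mem_con_of _ _).2 rfl)))
    refine (tau1 α).trans ((tau1 α).mul ((tau1 α).refl _) hw) ?_
    simp only [mem_con_mul, mem_con_of]
    rcases hz with rfl | rfl
    · rw [letterIf_pos z (P := z = z ∨ z ∈ con w) (.inl rfl), ← mul_assoc]
      simp only [hxy.symm, false_or]
      exact (tau1 α).mul (tau1_of_mul_letterIf _ _) ((tau1 α).refl _)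
    · have hx := h.2 rfl
      simp only [hx, hxy, or_self, true_or, letterIf_pos, letterIf_neg, not_false_eq_true,
        one_mul]
      exact tau1_of_mul_letterIf _ _

theorem exists_mul_of_mem_con {y : α} {u : FreeMonoid α} (h : y ∈ con u) :
    ∃ p s, u = p * FreeMonoid.of y * s := by
  obtain ⟨p, s, h⟩ := List.append_of_mem h
  exact ⟨FreeMonoid.ofList p, FreeMonoid.ofList s, FreeMonoid.toList.injective (by
    simp [h])⟩

/-- The unique y cuts the word into two powers of x, and only their being nonempty matters. -/
theorem tau1_normalForm_of_mem_of_notMem_mult {x y : α} (hxy : x ≠ y) (u : FreeMonoid α)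
    (hu : con u ⊆ {x, y}) (hy : y ∈ con u) (h : y ∉ mult u) :
    tau1 α u (letterIf x (before x y u) * FreeMonoid.of y * letterIf x (before y x u)) := by
  obtain ⟨p, s, rfl⟩ := exists_mul_of_mem_con hy
  simp only [mem_mult_mul, mem_con_mul, mem_con_of, not_or, not_and, or_true, true_imp_iff,
    and_true, mem_mult_of] at h
  obtain ⟨⟨-, -, hp⟩, -, hs⟩ := h
  have key : ∀ w : FreeMonoid α, con w ⊆ {x, y} → y ∉ con w →
      tau1 α w (letterIf x (x ∈ con w)) := by
    intro w hw hyw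
    have := tau1_normalForm_of_not_before hxy w hw fun hb => hyw hb.mem_con.1
    rwa [letterIf_neg y hyw, mul_one] at this
  have h1 : before x y (p * FreeMonoid.of y * s) ↔ x ∈ con p := by
    simp only [before_mul, before_of, mem_con_mul, mem_con_of, hs, and_false, or_false,
      false_or, and_true]
    exact ⟨fun h => h.elim (fun h => h.elim (fun h => (hp h.mem_con.2).elim) id)
      fun h => (hs h.mem_con.2).elim, fun h => .inl (.inr h)⟩
  have h2 : before y x (p * FreeMonoid.of y * s) ↔ x ∈ con s := by
    simp only [before_mul, before_of, mem_con_mul, mem_con_of, hp, hxy, and_false, or_false,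
      or_true, true_and]
    exact ⟨fun h => h.elim (fun h => (hp h.mem_con.1).elim)
      fun h => h.elim (fun h => (hs h.mem_con.1).elim) id, fun h => .inr (.inr h)⟩
  rw [h1, h2]
  refine (tau1 α).mul ((tau1 α).mul (key p (fun z hz => hu ?_) hp) ((tau1 α).refl _))
    (key s (fun z hz => hu ?_) hs)
  · simp [mem_con_mul, hz]
  · simp [mem_con_mul, hz]

theorem gamma_of_not_before {x y : α} (hxy : x ≠ y) {u v : FreeMonoid α} (hu : con u ⊆ {x, y})
    (hbu : ¬before y x u) (hbv : ¬before y x v) (hc : con u = con v) (hm : mult u = mult v) :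
    gamma α u v := by
  refine ⟨(tau1 α).trans (tau1_normalForm_of_not_before hxy u hu hbu) ?_, hm⟩
  rw [hc] at hu ⊢
  exact (tau1 α).symm (tau1_normalForm_of_not_before hxy v hu hbv)

theorem gamma_of_notMem_mult {x y : α} (hxy : x ≠ y) {u v : FreeMonoid α} (hu : con u ⊆ {x, y})
    (hy : y ∉ mult u) (h1 : before x y u ↔ before x y v) (h2 : before y x u ↔ before y x v)
    (hc : con u = con v) (hm : mult u = mult v) : gamma α u v := by
  by_cases h : y ∈ con u
  · refine ⟨(tau1 α).trans (tau1_normalForm_of_mem_of_notMem_mult hxy u hu h hy) ?_, hm⟩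
    rw [hc] at hu h
    rw [hm] at hy
    rw [h1, h2]
    exact (tau1 α).symm (tau1_normalForm_of_mem_of_notMem_mult hxy v hu h hy)
  · exact gamma_of_not_before hxy hu (fun hb => h hb.mem_con.1)
      (fun hb => h (hc ▸ hb.mem_con.1)) hc hm

/-! ### Words with the same values under all homomorphisms into a monoid -/

/-- The identity `u = v` holds in `N`. -/
def Satisfies (N : Type) [Monoid N] (u v : FreeMonoid α) : Prop :=
  ∀ h : FreeMonoid α →* N, h u = h v

theorem Satisfies.of_injective {M N : Type} [Monoid M] [Monoid N] {u v : FreeMonoid α}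
    (h : Satisfies N u v) (f : M →* N) (hf : Function.Injective f) : Satisfies M u v :=
  fun g => hf (h (f.comp g))

/-! ### Evaluations that detect content, multiplicity and order -/

section Eval

open Classical

/-- The value is a power of c whose exponent counts the occurrences of y, truncated at two by c³ =
c². -/
theorem lift_aperiodic {N : Type} [Monoid N] {c : N} (hc : c * (c * c) = c * c) (y : α)
    (u : FreeMonoid α) :
    FreeMonoid.lift (fun z => if z = y then c else 1) u =
      if y ∈ mult u then c * c else if y ∈ con u then c else 1 := by
  induction u using FreeMonoid.inductionOn' with
  | one => simp only [mem_mult_one, mem_con_one, if_false, map_one]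
  | of_mul w u ih =>
    rw [map_mul, ih, FreeMonoid.lift_eval_of]
    simp only [mem_mult_mul, mem_con_mul, mem_mult_of, mem_con_of, false_or, eq_comm (a := y)]
    by_cases h1 : w = y <;> by_cases h2 : y ∈ mult u <;> by_cases h3 : y ∈ con u <;>
      simp [h1, h2, h3, hc]

/-- Zero arises from cc = 0 (repeated y) or ec = 0 (x before y); an x after y is absorbed by ce = c.
-/
theorem lift_ec {x y : α} (hxy : x ≠ y) (u : FreeMonoid α) :
    FreeMonoid.lift (fun z => if z = y then EC.c else if z = x then EC.e else 1) u =
      if y ∈ mult u ∨ before x y u then EC.z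
        else if y ∈ con u then EC.c else if x ∈ con u then EC.e else .one := by
  induction u using FreeMonoid.inductionOn' with
  | one => simp only [mem_mult_one, mem_con_one, before_one, or_self, if_false]; rfl
  | of_mul w u ih =>
    rw [map_mul, ih, FreeMonoid.lift_eval_of]
    simp only [mem_mult_mul, mem_con_mul, mem_mult_of, mem_con_of, false_or, eq_comm (a := y),
      before_mul, before_of, eq_comm (a := x)]
    by_cases h1 : w = y <;> by_cases h4 : w = x <;> by_cases h2 : y ∈ mult u <;>
      by_cases h3 : y ∈ con u <;> by_cases h5 : before x y u <;> by_cases h6 : x ∈ con u <;>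
      simp only [h1, h2, h3, h4, h5, h6, hxy, hxy.symm, if_true, if_false, or_true, or_false,
        and_true, and_false, one_mul, or_self] <;> rfl

theorem lift_op_ec {x y : α} (hxy : x ≠ y) (u : FreeMonoid α) :
    (FreeMonoid.lift (fun z => MulOpposite.op
      (if z = y then EC.c else if z = x then EC.e else 1)) u).unop =
      if y ∈ mult u ∨ before y x u then EC.z
        else if y ∈ con u then EC.c else if x ∈ con u then EC.e else .one := by
  induction u using FreeMonoid.inductionOn' with
  | one => simp only [mem_mult_one, mem_con_one, before_one, or_self, if_false]; rfl
  | of_mul w u ih =>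
    rw [map_mul, MulOpposite.unop_mul, ih, FreeMonoid.lift_eval_of, MulOpposite.unop_op]
    simp only [mem_mult_mul, mem_con_mul, mem_mult_of, mem_con_of, false_or, eq_comm (a := y),
      before_mul, before_of, eq_comm (a := x)]
    by_cases h1 : w = y <;> by_cases h4 : w = x <;> by_cases h2 : y ∈ mult u <;>
      by_cases h3 : y ∈ con u <;> by_cases h5 : before y x u <;> by_cases h6 : x ∈ con u <;>
      simp only [h1, h2, h3, h4, h5, h6, hxy, hxy.symm, if_true, if_false, or_true, or_false,
        and_true, and_false, mul_one, or_self] <;> rfl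

/-- Both generators are idempotent, so ef = 0 is the only source of zero, whatever the
multiplicities. -/
theorem lift_ef {x y : α} (hxy : x ≠ y) (u : FreeMonoid α) :
    FreeMonoid.lift (fun z => if z = x then AC.e else if z = y then AC.f else 1) u =
      if before x y u then AC.z else if x ∈ con u then if y ∈ con u then AC.g else AC.e
        else if y ∈ con u then AC.f else .one := by
  induction u using FreeMonoid.inductionOn' with
  | one => simp only [mem_con_one, before_one, if_false]; rfl
  | of_mul w u ih =>
    rw [map_mul, ih, FreeMonoid.lift_eval_of]
    simp only [mem_con_mul, mem_con_of, false_or, eq_comm (a := y), before_mul, before_of,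
      eq_comm (a := x)]
    by_cases h1 : w = y <;> by_cases h4 : w = x <;>
      by_cases h3 : y ∈ con u <;> by_cases h5 : before x y u <;> by_cases h6 : x ∈ con u <;>
      simp only [h1, h3, h4, h5, h6, hxy, hxy.symm, if_true, if_false, or_true, or_false,
        and_true, and_false, one_mul, or_self] <;> rfl

theorem Satisfies.mult_iff_con_iff {N : Type} [Monoid N] {u v : FreeMonoid α}
    (h : Satisfies N u v) {c : N} (hc : c * (c * c) = c * c) (h1 : c ≠ 1) (h2 : c * c ≠ 1)
    (h3 : c * c ≠ c) (y : α) : (y ∈ mult u ↔ y ∈ mult v) ∧ (y ∈ con u ↔ y ∈ con v) := by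
  have := h (FreeMonoid.lift fun z => if z = y then c else 1)
  rw [lift_aperiodic hc, lift_aperiodic hc] at this
  have hu := @mult_subset_con _ u y
  have hv := @mult_subset_con _ v y
  grind

theorem Satisfies.con_eq_mult_eq {u v : FreeMonoid α} (h : Satisfies EC u v) :
    con u = con v ∧ mult u = mult v := by
  have := h.mult_iff_con_iff (c := .c) rfl EC.noConfusion EC.noConfusion EC.noConfusion
  exact ⟨Set.ext fun y => (this y).2, Set.ext fun y => (this y).1⟩

theorem Satisfies.con_eq_mult_eq_of_op {u v : FreeMonoid α} (h : Satisfies ECᵐᵒᵖ u v) :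
    con u = con v ∧ mult u = mult v := by
  have := h.mult_iff_con_iff (c := .op .c) rfl
    (fun h => EC.noConfusion (MulOpposite.op_injective h))
    (fun h => EC.noConfusion (MulOpposite.op_injective h))
    (fun h => EC.noConfusion (MulOpposite.op_injective h))
  exact ⟨Set.ext fun y => (this y).2, Set.ext fun y => (this y).1⟩

/-- With y not repeated in u, hence not in v, the value zero in `lift_ec` records exactly the order.
-/
theorem Satisfies.before_iff {x y : α} (hxy : x ≠ y) {u v : FreeMonoid α}
    (h : Satisfies EC u v) (hy : y ∉ mult u) : before x y u ↔ before x y v := by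
  have := h (FreeMonoid.lift fun z => if z = y then EC.c else if z = x then EC.e else 1)
  rw [lift_ec hxy, lift_ec hxy, ← h.con_eq_mult_eq.2] at this
  simp only [hy, false_or] at this
  split_ifs at this <;> simp_all

theorem Satisfies.before_iff_of_op {x y : α} (hxy : x ≠ y) {u v : FreeMonoid α}
    (h : Satisfies ECᵐᵒᵖ u v) (hy : y ∉ mult u) :
    before y x u ↔ before y x v := by
  have := congrArg MulOpposite.unop (h (FreeMonoid.lift fun z => MulOpposite.op
    (if z = y then EC.c else if z = x then EC.e else 1)))
  rw [lift_op_ec hxy, lift_op_ec hxy, ← h.con_eq_mult_eq_of_op.2] at this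
  simp only [hy, false_or] at this
  split_ifs at this <;> simp_all

theorem Satisfies.before_iff_of_AC {x y : α} (hxy : x ≠ y) {u v : FreeMonoid α}
    (h : Satisfies AC u v) : before x y u ↔ before x y v := by
  have := h (FreeMonoid.lift fun z => if z = x then AC.e else if z = y then AC.f else 1)
  rw [lift_ef hxy, lift_ef hxy] at this
  split_ifs at this <;> simp_all

end Eval

end ReesVar

namespace ReesVar

variable {α : Type}

/-! ### The monoids `MM (gamma α) W` -/

/-- The image of a word in `MM (gamma α) W`. -/
def mmk (W : Set (gamma α).Quotient) : FreeMonoid α →* MM (gamma α) W :=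
  (Con.mk' _).comp (Con.mk' (gamma α))

theorem mmk_surjective (W : Set (gamma α).Quotient) : Function.Surjective (mmk W) :=
  (Con.mk'_surjective).comp Con.mk'_surjective

theorem mmk_eq_iff {W : Set (gamma α).Quotient} {u v : FreeMonoid α} :
    mmk W u = mmk W v ↔ gamma α u v ∨
      (((u : (gamma α).Quotient) ∉ factorClosure W) ∧
        ((v : (gamma α).Quotient) ∉ factorClosure W)) := by
  refine (Con.eq _).trans ?_
  exact or_congr (Con.eq _) Iff.rfl

theorem mmk_eq_of_gamma {W : Set (gamma α).Quotient} {u v : FreeMonoid α} (h : gamma α u v) :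
    mmk W u = mmk W v := mmk_eq_iff.2 (.inl h)

theorem mmk_eq_of_notMem {W : Set (gamma α).Quotient} {u v : FreeMonoid α}
    (h : (u : (gamma α).Quotient) ∉ factorClosure W)
    (k : (v : (gamma α).Quotient) ∉ factorClosure W) :
    mmk W u = mmk W v := mmk_eq_iff.2 (.inr ⟨h, k⟩)

/-- All homomorphisms into `N` serve as the separating family. Non-factors are identified anyway, so
only identities with a factor on one side need testing. -/
theorem MM_mem_varGen {W : Set (gamma α).Quotient} {N : Type} [Monoid N]
    (h : ∀ u v : FreeMonoid α, (u : (gamma α).Quotient) ∈ factorClosure W →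
      Satisfies N u v → gamma α u v) : MonCat.of (MM (gamma α) W) ∈ varGen N := by
  refine (isVariety_varGen N).mem_of_separating (mmk W) (mmk_surjective W)
    (ι := FreeMonoid α →* N) (fun _ => MonCat.of N) (fun _ => self_mem_varGen N) id
    fun u v huv => ?_
  by_cases hu : (u : (gamma α).Quotient) ∈ factorClosure W
  · exact mmk_eq_of_gamma (h u v hu huv)
  by_cases hv : (v : (gamma α).Quotient) ∈ factorClosure W
  · exact mmk_eq_of_gamma ((gamma α).symm (h v u hv fun g => (huv g).symm))
  · exact mmk_eq_of_notMem hu hv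

/-- Fewer factors mean a larger ideal, so the quotient for `W` is an image of that for `W'`. -/
theorem varM_subset {W W' : Set (gamma α).Quotient} (h : W ⊆ factorClosure W') :
    varM W ⊆ varM W' := by
  have hW : factorClosure W ⊆ factorClosure W' := by
    rintro v ⟨u, hu, p, s, rfl⟩
    obtain ⟨w, hw, p', s', rfl⟩ := h hu
    exact ⟨_, hw, p' * p, s * s', by simp only [mul_assoc]⟩
  refine varGen_subset (isVariety_varGen _) ?_
  refine (isVariety_varGen _).mem_of_separating (mmk W) (mmk_surjective W)
    (ι := Unit) (fun _ => MonCat.of (MM (gamma α) W')) (fun _ => self_mem_varGen _)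
    (fun _ => mmk W') fun u v huv => ?_
  exact (mmk_eq_iff.1 (huv ())).elim mmk_eq_of_gamma fun h =>
    mmk_eq_of_notMem (fun k => h.1 (hW k)) fun k => h.2 (hW k)

theorem exists_gamma_of_mem_factorClosure {u w : FreeMonoid α}
    (h : (u : (gamma α).Quotient) ∈ factorClosure {(w : (gamma α).Quotient)}) :
    ∃ p s, gamma α w (p * u * s) := by
  obtain ⟨_, rfl, p, s, h⟩ := h
  induction p using Con.induction_on with
  | _ p =>
  induction s using Con.induction_on with
  | _ s => exact ⟨p, s, (Con.eq _).1 h⟩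

theorem mem_factorClosure_of_eq {W : Set (gamma α).Quotient} {u w : FreeMonoid α}
    (hw : (w : (gamma α).Quotient) ∈ W) (p s : FreeMonoid α) (h : w = p * u * s) :
    (u : (gamma α).Quotient) ∈ factorClosure W :=
  ⟨_, hw, p, s, by rw [h]; rfl⟩

/-! ### Monotonicity of the invariants under γ-factors -/

section Factor

variable {u w : FreeMonoid α}

theorem con_subset_of_factor (h : (u : (gamma α).Quotient) ∈
    factorClosure {(w : (gamma α).Quotient)}) : con u ⊆ con w := by
  obtain ⟨p, s, h⟩ := exists_gamma_of_mem_factorClosure h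
  intro x hx
  rw [con_eq_of_tau1 h.1, mem_con_mul, mem_con_mul]
  exact .inl (.inr hx)

theorem mult_subset_of_factor (h : (u : (gamma α).Quotient) ∈
    factorClosure {(w : (gamma α).Quotient)}) : mult u ⊆ mult w := by
  obtain ⟨p, s, h⟩ := exists_gamma_of_mem_factorClosure h
  intro x hx
  rw [h.2, mem_mult_mul, mem_mult_mul]
  exact .inl (.inr (.inl hx))

theorem before_of_factor (h : (u : (gamma α).Quotient) ∈
    factorClosure {(w : (gamma α).Quotient)}) {x y : α} (hxy : x ≠ y) (hb : before x y u) :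
    before x y w := by
  obtain ⟨p, s, h⟩ := exists_gamma_of_mem_factorClosure h
  rw [before_iff_of_tau1 hxy h.1, before_mul, before_mul]
  exact .inl (.inr (.inl hb))

end Factor

/-! ### Upper bounds for the varieties `varM W` -/

section Mem

open FreeMonoid

/-- A factor has t at most once and no a before t; E¹ carries both properties over to the other side
of the identity. -/
theorem MM_ta_mem {a t : α} (hat : a ≠ t) :
    MonCat.of (MM (gamma α) {letter t * plus a}) ∈ varGen EC := by
  refine MM_mem_varGen fun u v hu huv => ?_
  change (u : (gamma α).Quotient) ∈
    factorClosure {((of t * (of a * of a) : FreeMonoid α) : (gamma α).Quotient)} at hu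
  have hc := con_subset_of_factor hu
  have hm := @mult_subset_of_factor _ _ _ hu t
  have hb := before_of_factor hu hat
  simp only [mem_mult_mul, mem_mult_of, mem_con_mul, mem_con_of, before_mul, before_of, hat,
    hat.symm, or_self, and_self, and_false, imp_false] at hm hb
  refine gamma_of_not_before hat.symm (fun x hx => ?_) hb
    (by rwa [← huv.before_iff hat hm]) huv.con_eq_mult_eq.1 huv.con_eq_mult_eq.2
  simpa [mem_con_mul, mem_con_of] using hc hx

theorem MM_at_mem {a t : α} (hat : a ≠ t) :
    MonCat.of (MM (gamma α) {plus a * letter t}) ∈ varGen ECᵐᵒᵖ := by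
  refine MM_mem_varGen fun u v hu huv => ?_
  change (u : (gamma α).Quotient) ∈
    factorClosure {((of a * of a * of t : FreeMonoid α) : (gamma α).Quotient)} at hu
  have hc := con_subset_of_factor hu
  have hm := @mult_subset_of_factor _ _ _ hu t
  have hb := before_of_factor hu hat.symm
  simp only [mem_mult_mul, mem_mult_of, mem_con_mul, mem_con_of, before_mul, before_of, hat,
    hat.symm, or_self, and_self, and_true, imp_false] at hm hb
  refine gamma_of_not_before hat (fun x hx => ?_) hb
    (by rwa [← huv.before_iff_of_op hat hm]) huv.con_eq_mult_eq_of_op.1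
    huv.con_eq_mult_eq_of_op.2
  simpa [mem_con_mul, mem_con_of] using hc hx

/-- A factor has at most one t; the copies of E¹ and of its dual in B₀¹ see the letters before and
after it. -/
theorem MM_ata_mem {a t : α} (hat : a ≠ t) :
    MonCat.of (MM (gamma α) {plus a * letter t * plus a}) ∈ varGen BC := by
  refine MM_mem_varGen fun u v hu huv => ?_
  change (u : (gamma α).Quotient) ∈ factorClosure
    {((of a * of a * of t * (of a * of a) : FreeMonoid α) : (gamma α).Quotient)} at hu
  have hE := huv.of_injective EC.toBC EC.toBC_injective
  have hE' := huv.of_injective EC.opToBC EC.opToBC_injective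
  have hc := con_subset_of_factor hu
  have hm := @mult_subset_of_factor _ _ _ hu t
  simp only [mem_mult_mul, mem_mult_of, mem_con_mul, mem_con_of, hat.symm, or_self, and_self,
    false_and, and_false, imp_false] at hm
  refine gamma_of_notMem_mult hat (fun x hx => ?_) hm (hE.before_iff hat hm)
    (hE'.before_iff_of_op hat hm) hE.con_eq_mult_eq.1 hE.con_eq_mult_eq.2
  have := hc hx
  simp only [mem_con_mul, mem_con_of] at this
  simp only [Set.mem_insert_iff, Set.mem_singleton_iff]
  tauto

/-- Here both letters may repeat, so the order comes from A₀¹ itself and its copy of E¹ supplies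
only content and multiplicity. -/
theorem MM_ab_mem {a b : α} (hab : a ≠ b) :
    MonCat.of (MM (gamma α) {plus a * plus b}) ∈ varGen AC := by
  refine MM_mem_varGen fun u v hu huv => ?_
  change (u : (gamma α).Quotient) ∈ factorClosure
    {((of a * of a * (of b * of b) : FreeMonoid α) : (gamma α).Quotient)} at hu
  have hE := huv.of_injective EC.toAC EC.toAC_injective
  have hc := con_subset_of_factor hu
  have hb := before_of_factor hu hab.symm
  simp only [mem_con_mul, mem_con_of, before_mul, before_of, hab, hab.symm, or_self, and_self,
    false_and, and_false, imp_false] at hb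
  refine gamma_of_not_before hab (fun x hx => ?_) hb
    (by rwa [← huv.before_iff_of_AC hab.symm]) hE.con_eq_mult_eq.1 hE.con_eq_mult_eq.2
  simpa [mem_con_mul, mem_con_of] using hc hx

end Mem

/-! ### Lower bounds for the varieties `varM W` -/

/-- A monoid with zero embeds into `MM (gamma α) W` if its nonzero elements are represented by
factors with distinct contents. -/
theorem mem_varM_of_words {N : Type} [MonoidWithZero N] (W : Set (gamma α).Quotient)
    (r : N → FreeMonoid α) (h1 : r 1 = 1)
    (h0 : (r 0 : (gamma α).Quotient) ∉ factorClosure W)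
    (hf : ∀ x, x ≠ 0 → (r x : (gamma α).Quotient) ∈ factorClosure W)
    (hc : ∀ x y, x ≠ 0 → y ≠ 0 → con (r x) = con (r y) → x = y)
    (hr : ∀ x y, x ≠ 0 → y ≠ 0 → gamma α (r (x * y)) (r x * r y) ∨
      x * y = 0 ∧ ((r x * r y : FreeMonoid α) : (gamma α).Quotient) ∉ factorClosure W) :
    MonCat.of N ∈ varM W := by
  have ideal := compl_factorClosure_ideal W
  refine (isVariety_varGen _).sub_of (self_mem_varGen _)
    { toFun := fun x => mmk W (r x)
      map_one' := by rw [h1, map_one]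
      map_mul' := fun x y => ?_ } ?_
  · rw [← map_mul]
    by_cases hx : x = 0
    · rw [hx, zero_mul]
      exact mmk_eq_of_notMem h0 (ideal _ h0 (r y : (gamma α).Quotient)).2
    by_cases hy : y = 0
    · rw [hy, mul_zero]
      exact mmk_eq_of_notMem h0 (ideal _ h0 (r x : (gamma α).Quotient)).1
    rcases hr x y hx hy with h | ⟨h, k⟩
    · exact mmk_eq_of_gamma h
    · rw [h]
      exact mmk_eq_of_notMem h0 k
  · intro x y h
    have key : ∀ x y, x ≠ 0 → mmk W (r x) = mmk W (r y) → x = y := by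
      intro x y hx h
      rcases mmk_eq_iff.1 h with h | h
      · refine hc x y hx ?_ (con_eq_of_tau1 h.1)
        rintro rfl
        exact h0 ((Con.eq (gamma α)).2 h ▸ hf x hx)
      · exact (h.1 (hf x hx)).elim
    by_cases hx : x = 0
    · by_cases hy : y = 0
      · rw [hx, hy]
      · exact (key y x hy h.symm).symm
    · exact key x y hx h

theorem gamma_sq_mul_sq (a : α) :
    gamma α (FreeMonoid.of a * FreeMonoid.of a)
      (FreeMonoid.of a * FreeMonoid.of a * (FreeMonoid.of a * FreeMonoid.of a)) :=
  ⟨(tau1 α).symm ((tau1 α).mul (tau1_sq a) (tau1_sq a)), by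
    ext x
    simp [mem_mult_mul, mem_mult_of, mem_con_mul, mem_con_of]⟩

section Lower

open FreeMonoid

/-- Words over `t` and `a` representing the elements of `E¹`. -/
def wordE (a t : α) : EC → FreeMonoid α
  | .one => 1
  | .e => of a * of a
  | .c => of t * (of a * of a)
  -- Zero needs some non-factor; t² is one because t is not repeated in ta².
  | .z => of t * of t

/-- Words over `t` and `a` representing the elements of the dual of `E¹`. -/
def wordEOp (a t : α) : EC → FreeMonoid α
  | .one => 1
  | .e => of a * of a
  | .c => of a * of a * of t
  | .z => of t * of t

/-- Words over `a` and `b` representing the elements of `A₀¹`. -/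
def wordA (a b : α) : AC → FreeMonoid α
  | .one => 1
  -- Since fe = g survives and ef = 0, f takes the left block of a²b² and e the right one.
  | .f => of a * of a
  | .e => of b * of b
  | .g => of a * of a * (of b * of b)
  | .z => of b * of b * (of a * of a)

theorem EC_mem_varM {a t : α} (hat : a ≠ t) :
    MonCat.of EC ∈ varM {letter t * plus a} := by
  have nf : ∀ u : FreeMonoid α, t ∈ mult u ∨ before a t u → (u : (gamma α).Quotient) ∉
      factorClosure {letter t * plus a} := by
    intro u h hu
    change (u : (gamma α).Quotient) ∈
      factorClosure {((of t * (of a * of a) : FreeMonoid α) : (gamma α).Quotient)} at hu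
    have hm := @mult_subset_of_factor _ _ _ hu t
    have hb := before_of_factor hu hat
    simp only [mem_mult_mul, mem_mult_of, mem_con_mul, mem_con_of, before_mul, before_of, hat,
      hat.symm, or_self, and_self, and_false, imp_false] at hm hb
    exact h.elim hm hb
  have hw : ((of t * (of a * of a) : FreeMonoid α) : (gamma α).Quotient) ∈
    ({letter t * plus a} : Set (gamma α).Quotient) := rfl
  refine mem_varM_of_words _ (wordE a t) rfl (nf _ (.inl ?_)) ?_ ?_ ?_
  · exact (mem_mult_mul _ _ _).2 (.inr (.inr ⟨(mem_con_of _ _).2 rfl, (mem_con_of _ _).2 rfl⟩))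
  · rintro ⟨⟩ h
    · exact mem_factorClosure_of_eq hw (of t * (of a * of a)) 1 rfl
    · exact mem_factorClosure_of_eq hw (of t) 1 rfl
    · exact mem_factorClosure_of_eq hw 1 1 rfl
    · exact (h rfl).elim
  · intro x y hx hy h
    have ha := Set.ext_iff.1 h a
    have ht := Set.ext_iff.1 h t
    rcases x with _ | _ | _ | _ <;> rcases y with _ | _ | _ | _ <;>
      simp [wordE, mem_con_one, mem_con_mul, mem_con_of, hat.symm] at ha ht hx hy ⊢
    all_goals first | exact hx rfl | exact hy rfl
  · rintro ⟨⟩ ⟨⟩ hx hy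
    case e.e => exact .inl (gamma_sq_mul_sq a)
    case c.e =>
      refine .inl ?_
      change gamma α _ (of t * (of a * of a) * (of a * of a))
      rw [mul_assoc (of t)]
      exact (gamma α).mul ((gamma α).refl (of t)) (gamma_sq_mul_sq a)
    -- In both products some a precedes t, so they leave the factors of ta².
    case e.c | c.c =>
      refine .inr ⟨rfl, nf _ (.inr ?_)⟩
      simp [wordE, before_mul, mem_con_mul, mem_con_of]
    all_goals first | exact .inl ((gamma α).refl _) | exact (hx rfl).elim | exact (hy rfl).elim

theorem op_EC_mem_varM {a t : α} (hat : a ≠ t) :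
    MonCat.of ECᵐᵒᵖ ∈ varM {plus a * letter t} := by
  have nf : ∀ u : FreeMonoid α, t ∈ mult u ∨ before t a u → (u : (gamma α).Quotient) ∉
      factorClosure {plus a * letter t} := by
    intro u h hu
    change (u : (gamma α).Quotient) ∈
      factorClosure {((of a * of a * of t : FreeMonoid α) : (gamma α).Quotient)} at hu
    have hm := @mult_subset_of_factor _ _ _ hu t
    have hb := before_of_factor hu hat.symm
    simp only [mem_mult_mul, mem_mult_of, mem_con_mul, mem_con_of, before_mul, before_of, hat,
      hat.symm, or_self, and_self, and_true, imp_false] at hm hb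
    exact h.elim hm hb
  have hw : ((of a * of a * of t : FreeMonoid α) : (gamma α).Quotient) ∈
    ({plus a * letter t} : Set (gamma α).Quotient) := rfl
  have hinj : ∀ x y : EC, x ≠ .z → y ≠ .z → con (wordEOp a t x) = con (wordEOp a t y) →
      x = y := by
    intro x y hx hy h
    have ha := Set.ext_iff.1 h a
    have ht := Set.ext_iff.1 h t
    rcases x with _ | _ | _ | _ <;> rcases y with _ | _ | _ | _ <;>
      simp [wordEOp, mem_con_one, mem_con_mul, mem_con_of, hat.symm] at ha ht hx hy ⊢
  -- Multiplication is reversed in the dual, so the word for `y * x` is compared with that of x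
  -- followed by that of y.
  have hmul : ∀ y x : EC, x ≠ .z → y ≠ .z →
      gamma α (wordEOp a t (y * x)) (wordEOp a t x * wordEOp a t y) ∨ y * x = .z ∧
        ((wordEOp a t x * wordEOp a t y : FreeMonoid α) : (gamma α).Quotient) ∉
          factorClosure {plus a * letter t} := by
    rintro ⟨⟩ ⟨⟩ hx hy
    case e.e => exact .inl (gamma_sq_mul_sq a)
    case c.e =>
      refine .inl ?_
      change gamma α (of a * of a * of t) (of a * of a * (of a * of a * of t))
      rw [← mul_assoc (of a * of a) (of a * of a)]
      exact (gamma α).mul (gamma_sq_mul_sq a) ((gamma α).refl (of t))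
    case e.c | c.c =>
      refine .inr ⟨rfl, nf _ (.inr ?_)⟩
      simp [wordEOp, before_mul, mem_con_mul, mem_con_of]
    all_goals first | exact .inl ((gamma α).refl _) | exact (hx rfl).elim | exact (hy rfl).elim
  have ne_z : ∀ x : ECᵐᵒᵖ, x ≠ 0 → x.unop ≠ .z :=
    fun x hx h => hx (MulOpposite.unop_injective h)
  refine mem_varM_of_words _ (fun x => wordEOp a t x.unop) rfl (nf _ (.inl ?_)) ?_ ?_ ?_
  · exact (mem_mult_mul _ _ _).2 (.inr (.inr ⟨(mem_con_of _ _).2 rfl, (mem_con_of _ _).2 rfl⟩))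
  · rintro ⟨⟨⟩⟩ h
    · exact mem_factorClosure_of_eq hw (of a * of a * of t) 1 rfl
    · exact mem_factorClosure_of_eq hw 1 (of t) rfl
    · exact mem_factorClosure_of_eq hw 1 1 rfl
    · exact (h rfl).elim
  · exact fun x y hx hy h =>
      MulOpposite.unop_injective (hinj _ _ (ne_z x hx) (ne_z y hy) h)
  · exact fun x y hx hy => (hmul y.unop x.unop (ne_z x hx) (ne_z y hy)).imp id
      (And.imp_left fun h => MulOpposite.unop_injective h)

theorem AC_mem_varM {a b : α} (hab : a ≠ b) : MonCat.of AC ∈ varM {plus a * plus b} := by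
  have nf : ∀ u : FreeMonoid α, before b a u → (u : (gamma α).Quotient) ∉
      factorClosure {plus a * plus b} := by
    intro u h hu
    change (u : (gamma α).Quotient) ∈
      factorClosure {((of a * of a * (of b * of b) : FreeMonoid α) : (gamma α).Quotient)} at hu
    have hb := before_of_factor hu hab.symm h
    simp [mem_con_mul, mem_con_of, before_mul, before_of, hab, hab.symm] at hb
  have hw : ((of a * of a * (of b * of b) : FreeMonoid α) : (gamma α).Quotient) ∈
    ({plus a * plus b} : Set (gamma α).Quotient) := rfl
  refine mem_varM_of_words _ (wordA a b) rfl (nf _ ?_) ?_ ?_ ?_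
  · change before b a (of b * of b * (of a * of a))
    simp [before_mul, mem_con_mul, mem_con_of]
  · rintro ⟨⟩ h
    · exact mem_factorClosure_of_eq hw (of a * of a * (of b * of b)) 1 rfl
    · exact mem_factorClosure_of_eq hw (of a * of a) 1 rfl
    · exact mem_factorClosure_of_eq hw 1 (of b * of b) rfl
    · exact mem_factorClosure_of_eq hw 1 1 rfl
    · exact (h rfl).elim
  · intro x y hx hy h
    have ha := Set.ext_iff.1 h a
    have ht := Set.ext_iff.1 h b
    rcases x with _ | _ | _ | _ | _ <;> rcases y with _ | _ | _ | _ | _ <;>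
      first
        | rfl
        | exact (hx rfl).elim
        | exact (hy rfl).elim
        | simp [wordA, mem_con_one, mem_con_mul, mem_con_of, hab, hab.symm] at ha ht
  · have hfg : gamma α (of a * of a * (of b * of b))
        (of a * of a * (of a * of a * (of b * of b))) := by
      rw [← mul_assoc (of a * of a) (of a * of a)]
      exact (gamma α).mul (gamma_sq_mul_sq a) ((gamma α).refl (of b * of b))
    have hge : gamma α (of a * of a * (of b * of b))
        (of a * of a * (of b * of b) * (of b * of b)) := by
      rw [mul_assoc (of a * of a) (of b * of b)]
      exact (gamma α).mul ((gamma α).refl (of a * of a)) (gamma_sq_mul_sq b)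
    rintro ⟨⟩ ⟨⟩ hx hy
    case e.e | f.f => exact .inl (gamma_sq_mul_sq _)
    case f.g => exact .inl hfg
    case g.e => exact .inl hge
    case e.f | e.g | g.f | g.g =>
      refine .inr ⟨rfl, nf _ ?_⟩
      simp [wordA, before_mul, mem_con_mul, mem_con_of]
    all_goals first | exact (hx rfl).elim | exact (hy rfl).elim | exact .inl ((gamma α).refl _)

end Lower

/-! ### Equalities of varieties -/

theorem varGen_E1 {a t : α} (hat : a ≠ t) : varGen E1 = varM {letter t * plus a} :=
  (varGen_congr E1Equiv).trans (varGen_eq (EC_mem_varM hat) (MM_ta_mem hat))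

theorem dual_varGen_E1_eq_op : dual (varGen E1) = varGen ECᵐᵒᵖ := by
  rw [varGen_congr E1Equiv, dual_varGen]

theorem dual_varGen_E1 {a t : α} (hat : a ≠ t) :
    dual (varGen E1) = varM {plus a * letter t} :=
  dual_varGen_E1_eq_op.trans (varGen_eq (op_EC_mem_varM hat) (MM_at_mem hat))

theorem varGen_A01 {a b : α} (hab : a ≠ b) : varGen A01 = varM {plus a * plus b} :=
  (varGen_congr A01Equiv).trans (varGen_eq (AC_mem_varM hab) (MM_ab_mem hab))

theorem join_varGen_E1_dual : join (varGen E1) (dual (varGen E1)) = varGen B01 := by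
  rw [dual_varGen_E1_eq_op, varGen_congr E1Equiv, varGen_congr B01Equiv]
  have hB := isVariety_varGen BC
  apply Set.Subset.antisymm
  · refine varClass_subset hB (Set.union_subset ?_ ?_)
    · exact varGen_subset hB (hB.sub_of (self_mem_varGen _) EC.toBC EC.toBC_injective)
    · exact varGen_subset hB (hB.sub_of (self_mem_varGen _) EC.opToBC EC.opToBC_injective)
  · refine varGen_subset (isVariety_varClass _) ((isVariety_varClass _).BC_mem ?_ ?_)
    · exact subset_varClass _ (.inl (self_mem_varGen EC))
    · exact subset_varClass _ (.inr (self_mem_varGen ECᵐᵒᵖ))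

theorem varM_pair_subset {a t : α} :
    varM {letter t * plus a, plus a * letter t} ⊆ varM {plus a * letter t * plus a} := by
  refine varM_subset ?_
  rintro _ (rfl | rfl)
  · exact ⟨_, rfl, plus a, 1, by rw [mul_one, mul_assoc]⟩
  · exact ⟨_, rfl, 1, plus a, by rw [one_mul]⟩

theorem varM_ata_subset {a t : α} (hat : a ≠ t) :
    varM {plus a * letter t * plus a} ⊆ varGen B01 := by
  rw [varGen_congr B01Equiv]
  exact varGen_subset (isVariety_varGen BC) (MM_ata_mem hat)

/-- Since B₀¹ divides E¹ times its dual, it suffices that each lies in the variety, one for each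
word of the pair. -/
theorem varGen_B01_subset {a t : α} (hat : a ≠ t) :
    varGen B01 ⊆ varM {letter t * plus a, plus a * letter t} := by
  rw [varGen_congr B01Equiv]
  refine varGen_subset (isVariety_varGen _) ((isVariety_varGen _).BC_mem ?_ ?_)
  · refine varM_subset ?_ (EC_mem_varM hat)
    rintro _ rfl
    exact ⟨_, .inl rfl, 1, 1, by rw [one_mul, mul_one]⟩
  · refine varM_subset ?_ (op_EC_mem_varM hat)
    rintro _ rfl
    exact ⟨_, .inr rfl, 1, 1, by rw [one_mul, mul_one]⟩

end ReesVar

open ReesVar in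
theorem theorem4p1 (α : Type) [Countable α] [Infinite α] (a b t : α)
    (hab : a ≠ b) (hat : a ≠ t) :
    varGen E1 = varM {letter t * plus a} ∧
    dual (varGen E1) = varM {plus a * letter t} ∧
    (join (varGen E1) (dual (varGen E1)) = varGen B01 ∧
      varGen B01 = varM {letter t * plus a, plus a * letter t} ∧
      varM {letter t * plus a, plus a * letter t} = varM {plus a * letter t * plus a}) ∧
    varGen A01 = varM {plus a * plus b} :=
  ⟨varGen_E1 hat, dual_varGen_E1 hat,
    ⟨join_varGen_E1_dual,
      -- One cycle of three inclusions yields both remaining equalities.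
      (varGen_B01_subset hat).antisymm (varM_pair_subset.trans (varM_ata_subset hat)),
      varM_pair_subset.antisymm ((varM_ata_subset hat).trans (varGen_B01_subset hat))⟩,
    varGen_A01 hab⟩
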